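/- Let $\nu = 3\mu+1$ be a prime number, let $\zeta$ be a primitive $\nu$-th root of unity, let $g$ be a primitive root modulo $\nu$, and let $K=\mathbb{Q}(\varepsilon_0,\varepsilon_1,\varepsilon_2)\subseteq\mathbb{Q}(\zeta)$ be the field generated by the three $\mu$-fold Gaussian periods $$\varepsilon_i=\sum_{j=0}^{\mu-1}\zeta^{g^{3j+i}}\qquad(i=0,1,2).$$ For a number field $K$ of degree $n$ with ring of integers $\mathcal{O}_K$, integral basis $\xi_0,\dots,\xi_{n-1}$ and discriminant $d_K$, write $\theta^k=\sum_i a_{ik}\xi_i$ with $a_{ik}\in\mathbb{Z}$ for $\theta\in\mathcal{O}_K$ and $0\le k<n$, so that $\operatorname{disc}(1,\theta,\dots,\theta^{n-1})=\det(a_{ik})^2\,d_K$. A prime $p$ is called a common inessential discriminant divisor (common index divisor) of $K$ if $p\mid\det(a_{ik})^2$ for every $\theta\in\mathcal{O}_K$; equivalently, $p$ divides the index $[\mathcal{O}_K:\mathbb{Z}[\theta]]$ for every $\theta\in\mathcal{O}_K$ with $K=\mathbb{Q}(\theta)$. Then $K$ is a cyclic cubic extension of $\mathbb{Q}$, and $2$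 is a common inessential discriminant divisor of $K$ if and only if there are integers $A$, $B$ with $$\nu=A^2+27B^2.$$ -/

import Mathlib

open scoped NumberField

/-- The `i`-th `μ`-fold Gaussian period `∑_{0 ≤ j < μ} ζ ^ (g ^ (3 j + i))` of the `ν`-th roots of
unity, where `ν = 3 μ + 1` is a prime, `ζ` is a primitive `ν`-th root of unity and `g` is a
primitive root modulo `ν`. -/
def cubicPeriod {L : Type*} [Field L] (ν μ : ℕ) (ζ : L) (g : (ZMod ν)ˣ) (i : Fin 3) : L :=
  ∑ j ∈ Finset.range μ, ζ ^ ((g ^ (3 * j + (i : ℕ)) : (ZMod ν)ˣ) : ZMod ν).val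

/-- The field generated over `ℚ` by the three `μ`-fold periods of the `ν`-th roots of unity. -/
def cubicPeriodField {L : Type*} [Field L] [CharZero L] (ν μ : ℕ) (ζ : L) (g : (ZMod ν)ˣ) :
    IntermediateField ℚ L :=
  IntermediateField.adjoin ℚ (Set.range (cubicPeriod ν μ ζ g))

section Index

variable (K : Type*) [Field K] [NumberField K]

/-- For an integral basis `ξ_0, …, ξ_{n-1}` of a number field `K` of degree `n` and an algebraic
integer `θ` of `K`, the matrix `(a_{ik})` of integers with `θ ^ k = ∑ i, a_{ik} ξ_i`, for
`0 ≤ k < n`. -/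
noncomputable def powerCoordMatrix (θ : 𝓞 K) :
    Matrix (Fin (Module.finrank ℤ (𝓞 K))) (Fin (Module.finrank ℤ (𝓞 K))) ℤ :=
  Matrix.of fun i k => (Module.finBasis ℤ (𝓞 K)).repr (θ ^ (k : ℕ)) i

/-- The inessential part `|a_{ik}| ^ 2` of the equation discriminant
`disc(1, θ, …, θ ^ (n - 1)) = |a_{ik}| ^ 2 * d_K`. It does not depend on the integral basis: it is
the square of the index of `ℤ[θ]` in `𝓞 K` if `θ` generates `K`, and it is `0` otherwise. -/
noncomputable def inessentialPart (θ : 𝓞 K) : ℤ :=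
  (powerCoordMatrix K θ).det ^ 2

/-- The prime `p` is a common inessential discriminant divisor (a common index divisor) of `K`
if it divides the inessential part of the discriminant of every algebraic integer of `K`. -/
def IsCommonInessentialDiscriminantDivisor (p : ℕ) : Prop :=
  ∀ θ : 𝓞 K, (p : ℤ) ∣ inessentialPart K θ

end Index

/-! Modulo 2, squaring acts on the integers of ℚ(ζ) as the automorphism ζ ↦ ζ². If 2 is a cube
modulo ν, this automorphism is trivial on K, so θ² ≡ θ for every integer θ of K, and 1, θ, θ² are
always dependent modulo 2. Otherwise ε₀² ≡ ε_r with r ≠ 0, and 1, ε₀, ε_r are independent modulo 2,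
so ε₀ has odd index. Hence 2 is a common index divisor exactly when it is a cube
(`isCommonInessentialDiscriminantDivisor_two_iff`). Gauss's criterion
`MulChar.apply_two_eq_one_iff_exists_sq_add_mul_sq` does the rest. For a cubic character χ, the
Jacobi sum J(χ, χ) = a + 3mω is congruent to χ(2) modulo 2 and has norm ν, so 4ν = (2a - 3m)² +
27m². Then χ(2) = 1 iff m is even, and uniqueness of this representation up to signs turns that into
ν = A² + 27B². -/

/-- A prime has at most one representation `4 p = X ^ 2 + 27 Y ^ 2`, up to signs. -/
theorem sq_eq_sq_of_sq_add_mul_sq_eq_four_mul_prime {p : ℕ} (hp : p.Prime) {X Y U V : ℤ}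
    (h₁ : X ^ 2 + 27 * Y ^ 2 = 4 * p) (h₂ : U ^ 2 + 27 * V ^ 2 = 4 * p) : Y ^ 2 = V ^ 2 := by
  have hpos : (0 : ℤ) < p := by exact_mod_cast hp.pos
  have key : ∀ U : ℤ, U ^ 2 + 27 * V ^ 2 = 4 * p → (p : ℤ) ∣ X * V - U * Y → Y ^ 2 = V ^ 2 := by
    intro U h₂ hd
    have h0 : X * V - U * Y = 0 := by
      obtain ⟨t, ht⟩ := hd
      -- Brahmagupta's identity for the product of the two forms; it gives 27t² ≤ 16, hence t = 0.
      have e : (X * U + 27 * Y * V) ^ 2 + 27 * (p * t) ^ 2 = 16 * (p : ℤ) ^ 2 := by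
        rw [← ht]; linear_combination (U ^ 2 + 27 * V ^ 2) * h₁ + 4 * (p : ℤ) * h₂
      have ht2 : t ^ 2 < 1 := by
        by_contra hcon
        have hp2 : (0 : ℤ) < (p : ℤ) ^ 2 := by positivity
        nlinarith [sq_nonneg (X * U + 27 * Y * V)]
      have : t = 0 := by nlinarith [sq_nonneg t, pow_eq_zero_iff (two_ne_zero) (a := t)]
      rw [ht, this, mul_zero]
    have e : 4 * (p : ℤ) * (V ^ 2 - Y ^ 2) = 0 := by
      linear_combination (X * V + U * Y) * h0 - V ^ 2 * h₁ + Y ^ 2 * h₂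
    rcases mul_eq_zero.1 e with h | h
    · omega
    · linarith
  have hd : (p : ℤ) ∣ (X * V - U * Y) * (X * V - (-U) * Y) :=
    ⟨4 * (V ^ 2 - Y ^ 2), by linear_combination V ^ 2 * h₁ - Y ^ 2 * h₂⟩
  rcases (Nat.prime_iff_prime_int.1 hp).dvd_or_dvd hd with h | h
  · exact key U h₂ h
  · exact key (-U) (by rw [neg_sq]; exact h₂) h

/-- A sum over a finite set with a fixed-point-free involution under which the summand is
invariant is twice an element of any subgroup containing the summands. -/
theorem exists_sum_eq_two_nsmul_of_involution {ι M : Type*} [AddCommGroup M] (H : AddSubgroup M)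
    (s : Finset ι) (f : ι → M) (hf : ∀ x ∈ s, f x ∈ H) (σ : ι → ι) (hσ : ∀ x ∈ s, σ x ∈ s)
    (hσσ : ∀ x ∈ s, σ (σ x) = x) (hne : ∀ x ∈ s, σ x ≠ x) (hfσ : ∀ x ∈ s, f (σ x) = f x) :
    ∃ h ∈ H, ∑ x ∈ s, f x = 2 • h := by
  let N : AddSubgroup M := H.map (nsmulAddMonoidHom 2)
  have hz : ∑ x ∈ s, (QuotientAddGroup.mk' N) (f x) = 0 := by
    refine Finset.sum_involution (fun x _ => σ x) ?_ (fun x hx _ => hne x hx) hσ hσσ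
    intro x hx
    rw [hfσ x hx, ← two_nsmul, ← map_nsmul]
    exact (QuotientAddGroup.eq_zero_iff _).2 ⟨f x, hf x hx, rfl⟩
  rw [← map_sum] at hz
  obtain ⟨h, hh, e⟩ := (QuotientAddGroup.eq_zero_iff _).1 hz
  exact ⟨h, hh, e.symm⟩

/-! ### Coordinates in ℤ[ω]. -/

section Eisenstein

variable {ω : ℂ}

theorem IsPrimitiveRoot.sq_eq_neg_one_sub (hω : IsPrimitiveRoot ω 3) : ω ^ 2 = -1 - ω := by
  have h := hω.geom_sum_eq_zero (by norm_num)
  simp only [Finset.sum_range_succ, Finset.sum_range_zero] at h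
  linear_combination h

theorem IsPrimitiveRoot.exists_eq_intCast_add_mul (hω : IsPrimitiveRoot ω 3) {z : ℂ}
    (hz : z ∈ Algebra.adjoin ℤ {ω}) : ∃ c d : ℤ, z = c + d * ω := by
  induction hz using Algebra.adjoin_induction with
  | mem x hx => exact ⟨0, 1, by rw [Set.mem_singleton_iff.1 hx]; simp⟩
  | algebraMap r => exact ⟨r, 0, by simp⟩
  | add x y _ _ hx hy =>
    obtain ⟨a, b, rfl⟩ := hx
    obtain ⟨c, d, rfl⟩ := hy
    exact ⟨a + c, b + d, by push_cast; ring⟩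
  | mul x y _ _ hx hy =>
    obtain ⟨a, b, rfl⟩ := hx
    obtain ⟨c, d, rfl⟩ := hy
    exact ⟨a * c - b * d, a * d + b * c - b * d, by
      push_cast; linear_combination (b * d : ℂ) * hω.sq_eq_neg_one_sub⟩

theorem IsPrimitiveRoot.intCast_add_mul_inj (hω : IsPrimitiveRoot ω 3) {a b c d : ℤ}
    (h : (a + b * ω : ℂ) = c + d * ω) : a = c ∧ b = d := by
  -- The norm of the difference (a - c) + (b - d)ω, a positive definite form.
  have h2 : (((a - c) ^ 2 - (a - c) * (b - d) + (b - d) ^ 2 : ℤ) : ℂ) = 0 := by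
    push_cast
    linear_combination ((a - c) + (b - d) * (-1 - ω) : ℂ) * h +
      (b - d : ℂ) ^ 2 * hω.sq_eq_neg_one_sub
  have h3 : (a - c) ^ 2 - (a - c) * (b - d) + (b - d) ^ 2 = 0 := by exact_mod_cast h2
  have h4 : (b - d) ^ 2 = 0 := by
    nlinarith [sq_nonneg (2 * (a - c) - (b - d)), sq_nonneg (b - d)]
  have h5 : b - d = 0 := by simpa using h4
  have h6 : (a - c) ^ 2 = 0 := by rw [h5] at h3; linarith
  have h7 : a - c = 0 := by simpa using h6
  omega

end Eisenstein

/-! ### Cubic Jacobi sums and the cubic character of 2. -/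

section CubicCharacter

variable {p : ℕ} [Fact p.Prime] {χ : MulChar (ZMod p) ℂ} {ω : ℂ}

/-- The cubic Jacobi sum `J(χ, χ)` is congruent to `χ 2` modulo `2`. -/
theorem exists_jacobiSum_eq_add_two_mul (hp : p ≠ 2) (hχ : χ ^ 3 = 1) (hω : IsPrimitiveRoot ω 3) :
    ∃ h ∈ Algebra.adjoin ℤ {ω}, jacobiSum χ χ = χ 2 + 2 * h := by
  have h2 : (2 : ZMod p) ≠ 0 := Ring.two_ne_zero (by rwa [ZMod.ringChar_zmod_n])
  have hmem : ∀ x : ZMod p, χ x ∈ Algebra.adjoin ℤ {ω} :=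
    fun x => MulChar.apply_mem_algebraAdjoin_of_pow_eq_one hχ hω x
  -- The involution x ↦ 1 - x pairs equal terms and fixes only x = 1/2, whose term is χ(2)⁻² = χ(2).
  obtain ⟨h, hh, e⟩ := exists_sum_eq_two_nsmul_of_involution
    (Subalgebra.toSubmodule (Algebra.adjoin ℤ {ω})).toAddSubgroup
    (Finset.univ.erase (2⁻¹ : ZMod p)) (fun x => χ x * χ (1 - x))
    (fun x _ => (Algebra.adjoin ℤ {ω}).mul_mem (hmem x) (hmem _)) (fun x => 1 - x)
    (fun x hx => by
      simp only [Finset.mem_erase, Finset.mem_univ, and_true] at hx ⊢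
      intro h
      apply hx
      field_simp at h ⊢
      linear_combination -h)
    (fun x _ => by ring)
    (fun x hx h => by
      simp only [Finset.mem_erase, Finset.mem_univ, and_true] at hx
      apply hx
      field_simp
      linear_combination -h)
    (fun x _ => by rw [sub_sub_cancel, mul_comm])
  refine ⟨h, hh, ?_⟩
  rw [jacobiSum, ← Finset.add_sum_erase _ _ (Finset.mem_univ (2⁻¹ : ZMod p)), e, two_nsmul, two_mul]
  congr 1
  have e1 : (1 - 2⁻¹ : ZMod p) = 2⁻¹ := by field_simp; ring
  have e2 : χ 2 * χ 2⁻¹ = 1 := by rw [← map_mul, mul_inv_cancel₀ h2, map_one]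
  have e3 : χ 2 ^ 3 = 1 := by
    rw [← MulChar.pow_apply' χ (by norm_num), hχ, MulChar.one_apply h2.isUnit]
  rw [e1]
  linear_combination (χ 2 * (χ 2 * χ 2⁻¹ + 1)) * e2 - χ 2⁻¹ ^ 2 * e3

/-- The cubic Jacobi sum is `a + 3 m ω` for integers `a`, `m` with
`4 p = (2 a - 3 m) ^ 2 + 27 m ^ 2`. -/
theorem exists_jacobiSum_eq_and_four_mul_eq (hχ : orderOf χ = 3) (hp : 3 ∣ p - 1)
    (hω : IsPrimitiveRoot ω 3) :
    ∃ a m : ℤ, jacobiSum χ χ = a + 3 * m * ω ∧ (2 * a - 3 * m) ^ 2 + 27 * m ^ 2 = 4 * p := by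
  have hχ3 : χ ^ 3 = 1 := hχ ▸ pow_orderOf_eq_one χ
  have hχ1 : χ ≠ 1 := by rintro rfl; simp at hχ
  have hχ2 : χ * χ ≠ 1 := by
    intro h
    have := orderOf_dvd_of_pow_eq_one (n := 2) (by rw [sq, h] : χ ^ 2 = 1)
    rw [hχ] at this; omega
  -- J = -1 + z(ω - 1)², and (ω - 1)² = -3ω is what makes the ω-coefficient divisible by 3.
  obtain ⟨z, hz, e⟩ := exists_jacobiSum_eq_neg_one_add (by norm_num) hχ3 hχ3
    (by rwa [ZMod.card]) hω
  obtain ⟨c, d, rfl⟩ := hω.exists_eq_intCast_add_mul hz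
  have hw := hω.sq_eq_neg_one_sub
  have hJ : jacobiSum χ χ = ((3 * d - 1 : ℤ) : ℂ) + 3 * ((d - c : ℤ) : ℂ) * ω := by
    rw [e]; push_cast; linear_combination (c - 3 * d + d * ω : ℂ) * hw
  have hconj : χ⁻¹ = χ.ringHomComp (starRingEnd ℂ) := by
    ext x; rw [MulChar.inv_apply_eq_inv', MulChar.ringHomComp_apply]
    have e3 : χ x ^ 3 = 1 := by
      rw [← MulChar.pow_apply' χ (by norm_num), hχ3, MulChar.one_apply x.isUnit]
    rw [Complex.inv_eq_conj (Complex.norm_eq_one_of_pow_eq_one e3 (by norm_num))]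
  have hwc : (starRingEnd ℂ) ω = -1 - ω := by
    rw [← hw, ← Complex.inv_eq_conj (Complex.norm_eq_one_of_pow_eq_one hω.pow_eq_one (by norm_num))]
    refine inv_eq_of_mul_eq_one_right ?_
    rw [← hω.pow_eq_one]; ring
  have hnorm := jacobiSum_mul_jacobiSum_inv
    (by rw [ZMod.ringChar_zmod_n, ringChar.eq_zero]; exact (Fact.out : p.Prime).ne_zero.symm)
    hχ1 hχ1 hχ2
  rw [hconj, jacobiSum_ringHomComp, hJ, ZMod.card] at hnorm
  simp only [map_add, map_mul, map_intCast, hwc, map_ofNat] at hnorm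
  refine ⟨_, _, hJ, ?_⟩
  have : (((2 * (3 * d - 1) - 3 * (d - c)) ^ 2 + 27 * (d - c) ^ 2 : ℤ) : ℂ) = ((4 * p : ℤ) : ℂ) := by
    push_cast at hnorm ⊢
    linear_combination 4 * hnorm + 36 * (d - c : ℂ) ^ 2 * hw
  exact_mod_cast this

/-- Gauss's criterion for the cubic character of `2`. -/
theorem MulChar.apply_two_eq_one_iff_exists_sq_add_mul_sq (hχ : orderOf χ = 3) (hp : 3 ∣ p - 1) :
    χ 2 = 1 ↔ ∃ A B : ℤ, (p : ℤ) = A ^ 2 + 27 * B ^ 2 := by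
  obtain ⟨ω, hω⟩ : ∃ ω : ℂ, IsPrimitiveRoot ω 3 := ⟨_, Complex.isPrimitiveRoot_exp 3 (by norm_num)⟩
  have hχ3 : χ ^ 3 = 1 := hχ ▸ pow_orderOf_eq_one χ
  have hpp : p.Prime := Fact.out
  have hp2 : p ≠ 2 := by rintro rfl; omega
  obtain ⟨a, m, hJ, h4⟩ := exists_jacobiSum_eq_and_four_mul_eq hχ hp hω
  obtain ⟨z, hz, e⟩ := exists_jacobiSum_eq_add_two_mul hp2 hχ3 hω
  obtain ⟨c, d, rfl⟩ := hω.exists_eq_intCast_add_mul hz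
  rw [hJ] at e
  constructor
  · intro h1
    rw [h1] at e
    obtain ⟨-, hm⟩ := hω.intCast_add_mul_inj (a := a) (b := 3 * m) (c := 1 + 2 * c) (d := 2 * d)
      (by push_cast; linear_combination e)
    obtain ⟨k, rfl⟩ : (2 : ℤ) ∣ m := by omega
    exact ⟨a - 3 * k, k, by linarith⟩
  · rintro ⟨A, B, hAB⟩
    have hm : Even m := by
      have h := sq_eq_sq_of_sq_add_mul_sq_eq_four_mul_prime hpp h4
        (U := 2 * A) (V := 2 * B) (by rw [hAB]; ring)
      have : Even (m ^ 2) := by rw [h]; exact ⟨2 * B ^ 2, by ring⟩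
      simpa [Int.even_pow] using this
    have h2 : (2 : ZMod p) ≠ 0 := Ring.two_ne_zero (by rwa [ZMod.ringChar_zmod_n])
    obtain ⟨k, hk, hk'⟩ := MulChar.exists_apply_eq_pow hχ3 hω h2
    obtain ⟨n, rfl⟩ := hm
    rw [hk'] at e ⊢
    -- For χ(2) = ω or ω² = -1 - ω the ω-coefficient would be odd, against m even.
    interval_cases k
    · simp
    · obtain ⟨-, hm⟩ := hω.intCast_add_mul_inj (a := a) (b := 3 * (n + n)) (c := 2 * c)
        (d := 1 + 2 * d) (by push_cast at e ⊢; linear_combination e)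
      omega
    · rw [hω.sq_eq_neg_one_sub] at e
      obtain ⟨-, hm⟩ := hω.intCast_add_mul_inj (a := a) (b := 3 * (n + n)) (c := -1 + 2 * c)
        (d := -1 + 2 * d) (by push_cast at e ⊢; linear_combination e)
      omega

end CubicCharacter

/-! ### Index divisibility as linear dependence modulo p. -/

/-- A prime divides the inessential part of the discriminant of `θ` if and only if the powers
`1, θ, …, θ ^ (n - 1)` are linearly dependent modulo the prime. -/
theorem dvd_inessentialPart_iff (K : Type*) [Field K] [NumberField K] {p : ℕ} (hp : p.Prime)
    (θ : 𝓞 K) :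
    (p : ℤ) ∣ inessentialPart K θ ↔
      ∃ a : ℕ → ℤ, (∃ k < Module.finrank ℤ (𝓞 K), ¬ (p : ℤ) ∣ a k) ∧
        ∃ η : 𝓞 K, ∑ k ∈ Finset.range (Module.finrank ℤ (𝓞 K)), (a k : 𝓞 K) * θ ^ k = p * η := by
  have : Fact p.Prime := ⟨hp⟩
  let b := Module.finBasis ℤ (𝓞 K)
  have hdvd : ∀ x : 𝓞 K, (∃ η, x = p * η) ↔ ∀ i, (p : ℤ) ∣ b.repr x i := by
    intro x
    constructor
    · rintro ⟨η, rfl⟩ i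
      have e : (p : 𝓞 K) * η = (p : ℤ) • η := by rw [zsmul_eq_mul, Int.cast_natCast]
      rw [e, map_zsmul, Finsupp.smul_apply, smul_eq_mul]
      exact dvd_mul_right _ _
    · intro h
      choose c hc using h
      refine ⟨∑ i, c i • b i, ?_⟩
      rw [← b.sum_repr x, Finset.mul_sum]
      refine Finset.sum_congr rfl fun i _ => ?_
      rw [hc, zsmul_eq_mul, zsmul_eq_mul]; push_cast; ring
  have hcoord : ∀ (a : ℕ → ℤ) (i),
      b.repr (∑ k ∈ Finset.range (Module.finrank ℤ (𝓞 K)), (a k : 𝓞 K) * θ ^ k) i =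
      ∑ k : Fin (Module.finrank ℤ (𝓞 K)), powerCoordMatrix K θ i k * a k := by
    intro a i
    rw [Finset.sum_range, map_sum, Finsupp.finsetSum_apply]
    refine Finset.sum_congr rfl fun k _ => ?_
    rw [← zsmul_eq_mul, map_zsmul, Finsupp.smul_apply, smul_eq_mul, mul_comm]
    rfl
  rw [inessentialPart, (Nat.prime_iff_prime_int.1 hp).dvd_pow_iff_dvd two_ne_zero,
    ← ZMod.intCast_zmod_eq_zero_iff_dvd, Int.cast_det, ← Matrix.exists_mulVec_eq_zero_iff]
  simp only [hdvd, hcoord]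
  constructor
  · rintro ⟨v, hv, h⟩
    refine ⟨fun k => if hk : k < Module.finrank ℤ (𝓞 K) then ((v ⟨k, hk⟩).val : ℤ) else 0,
      ?_, fun i => ?_⟩
    · obtain ⟨k, hk⟩ := Function.ne_iff.1 hv
      refine ⟨k, k.2, fun hd => hk ?_⟩
      rw [← ZMod.intCast_zmod_eq_zero_iff_dvd] at hd
      simpa using hd
    · rw [← ZMod.intCast_zmod_eq_zero_iff_dvd]
      have := congrFun h i
      simpa [Matrix.mulVec, dotProduct] using this
  · rintro ⟨a, ⟨k, hk, hak⟩, h⟩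
    refine ⟨fun k => (a k : ZMod p), fun h0 => hak ?_, ?_⟩
    · rw [← ZMod.intCast_zmod_eq_zero_iff_dvd]
      exact congrFun h0 ⟨k, hk⟩
    · ext i
      have := (ZMod.intCast_zmod_eq_zero_iff_dvd _ p).2 (h i)
      simpa [Matrix.mulVec, dotProduct] using this

/-! ### The primitive p-th roots of unity as a basis. -/

section RootOfUnity

variable {M : Type*} [Monoid M] {ζ : M} {p : ℕ}

theorem pow_val_natCast_of_pow_eq_one (hζ : ζ ^ p = 1) (k : ℕ) :
    ζ ^ (k : ZMod p).val = ζ ^ k := by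
  rw [ZMod.val_natCast, ← pow_eq_pow_mod k hζ]

theorem pow_val_mul_of_pow_eq_one [NeZero p] (hζ : ζ ^ p = 1) (a b : ZMod p) :
    ζ ^ (a * b).val = (ζ ^ a.val) ^ b.val := by
  rw [← pow_mul, ← pow_val_natCast_of_pow_eq_one hζ (a.val * b.val)]
  simp

end RootOfUnity

section Span

variable {L : Type*} [Field L] {p : ℕ} [Fact p.Prime] {ζ : L}

theorem IsPrimitiveRoot.sum_units_pow_val (hζ : IsPrimitiveRoot ζ p) :
    ∑ u : (ZMod p)ˣ, ζ ^ (u : ZMod p).val = -1 := by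
  have hp : p.Prime := Fact.out
  have h := hζ.geom_sum_eq_zero hp.one_lt
  have h1 : ∑ a : ZMod p, ζ ^ a.val = 0 := by
    rw [← h, Finset.sum_range]
    obtain ⟨n, rfl⟩ : ∃ n, p = n + 1 := ⟨p - 1, by have := hp.pos; omega⟩
    rfl
  rw [← Finset.add_sum_erase _ _ (Finset.mem_univ (0 : ZMod p)), ZMod.val_zero, pow_zero] at h1
  have h2 : ∑ u : (ZMod p)ˣ, ζ ^ (u : ZMod p).val =
      ∑ a ∈ Finset.univ.erase (0 : ZMod p), ζ ^ a.val := by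
    refine Finset.sum_bij (fun u _ => (u : ZMod p)) (by simp) (fun u _ v _ h => Units.ext h)
      (fun a ha => ?_) (fun _ _ => rfl)
    exact ⟨Units.mk0 a (Finset.ne_of_mem_erase ha), Finset.mem_univ _, rfl⟩
  rw [h2]; linear_combination h1

theorem IsPrimitiveRoot.adjoin_le_span_units_pow_val (hζ : IsPrimitiveRoot ζ p) (R : Type*)
    [CommRing R] [Algebra R L] :
    Subalgebra.toSubmodule (Algebra.adjoin R {ζ}) ≤
      Submodule.span R (Set.range fun u : (ZMod p)ˣ => ζ ^ (u : ZMod p).val) := by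
  rw [Algebra.adjoin_eq_span, Submodule.span_le]
  intro x hx
  rw [SetLike.mem_coe, ← Submonoid.powers_eq_closure] at hx
  obtain ⟨k, rfl⟩ := hx
  rw [SetLike.mem_coe]
  change ζ ^ k ∈ _
  rw [← pow_val_natCast_of_pow_eq_one hζ.pow_eq_one k]
  -- An exponent divisible by p gives 1, which is minus the sum of all primitive roots.
  by_cases hk : (k : ZMod p) = 0
  · have : ζ ^ (k : ZMod p).val = -∑ u : (ZMod p)ˣ, ζ ^ (u : ZMod p).val := by
      rw [hζ.sum_units_pow_val, hk, ZMod.val_zero, pow_zero, neg_neg]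
    rw [this]
    exact neg_mem (sum_mem fun u _ => Submodule.subset_span ⟨u, rfl⟩)
  · exact Submodule.subset_span ⟨Units.mk0 _ hk, rfl⟩

end Span

section Cyclotomic

variable {L : Type*} [Field L] [NumberField L] {p : ℕ} [Fact p.Prime]
  [IsCyclotomicExtension {p} ℚ L] {ζ : L}

/-- The basis of the `p`-th cyclotomic field consisting of the primitive `p`-th roots of unity. -/
noncomputable def IsPrimitiveRoot.unitsPowBasis (hζ : IsPrimitiveRoot ζ p) :
    Module.Basis (ZMod p)ˣ ℚ L :=
  basisOfTopLeSpanOfCardEqFinrank (fun u : (ZMod p)ˣ => ζ ^ (u : ZMod p).val)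
    (by
      refine le_trans ?_ (hζ.adjoin_le_span_units_pow_val ℚ)
      rw [IsCyclotomicExtension.adjoin_primitive_root_eq_top (n := p) hζ]
      exact le_rfl)
    (by
      rw [IsCyclotomicExtension.finrank (n := p) L
        (Polynomial.cyclotomic.irreducible_rat (NeZero.pos p)), ZMod.card_units_eq_totient])

@[simp]
theorem IsPrimitiveRoot.unitsPowBasis_apply (hζ : IsPrimitiveRoot ζ p) (u : (ZMod p)ˣ) :
    hζ.unitsPowBasis u = ζ ^ (u : ZMod p).val := by
  simp [IsPrimitiveRoot.unitsPowBasis]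

theorem IsPrimitiveRoot.mem_adjoin_of_isIntegral (hζ : IsPrimitiveRoot ζ p) {x : L}
    (hx : IsIntegral ℤ x) : x ∈ Algebra.adjoin ℤ {ζ} := by
  have := IsCyclotomicExtension.Rat.isIntegralClosure_adjoin_singleton_of_prime hζ
  obtain ⟨y, rfl⟩ := (IsIntegralClosure.isIntegral_iff (A := Algebra.adjoin ℤ {ζ})).1 hx
  exact y.2

/-- The ring of integers is ℤ[ζ], already spanned over ℤ by the primitive roots. Congruences modulo
2 can therefore be read off coordinatewise. -/
theorem IsPrimitiveRoot.exists_unitsPowBasis_repr_eq_intCast (hζ : IsPrimitiveRoot ζ p) {x : L}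
    (hx : IsIntegral ℤ x) (u : (ZMod p)ˣ) : ∃ n : ℤ, hζ.unitsPowBasis.repr x u = n := by
  have h := hζ.adjoin_le_span_units_pow_val ℤ (hζ.mem_adjoin_of_isIntegral hx)
  clear hx
  induction h using Submodule.span_induction with
  | mem x hx =>
    obtain ⟨v, rfl⟩ := hx
    refine ⟨if v = u then 1 else 0, ?_⟩
    simp only [← hζ.unitsPowBasis_apply, Module.Basis.repr_self, Finsupp.single_apply]
    split_ifs <;> simp
  | zero => exact ⟨0, by simp⟩
  | add x y _ _ hx hy =>
    obtain ⟨a, ha⟩ := hx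
    obtain ⟨b, hb⟩ := hy
    exact ⟨a + b, by rw [map_add, Finsupp.add_apply, ha, hb, Int.cast_add]⟩
  | smul n x _ hx =>
    obtain ⟨a, ha⟩ := hx
    exact ⟨n * a, by rw [map_zsmul, Finsupp.smul_apply, ha, zsmul_eq_mul, Int.cast_mul]⟩

theorem IsPrimitiveRoot.unitsPowBasis_repr_one (hζ : IsPrimitiveRoot ζ p) (u : (ZMod p)ˣ) :
    hζ.unitsPowBasis.repr 1 u = -1 := by
  have : (1 : L) = -∑ u, hζ.unitsPowBasis u := by
    simp [hζ.sum_units_pow_val]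
  rw [this, map_neg, map_sum]
  simp only [Module.Basis.repr_self]
  simp [Finsupp.single_apply]

variable (L) in
/-- The automorphism of the `p`-th cyclotomic field that raises the `p`-th roots of unity to the
power `u`. -/
noncomputable def cyclotomicAut : (ZMod p)ˣ ≃* Gal(L/ℚ) :=
  (IsCyclotomicExtension.Rat.galEquivZMod p L).symm

theorem cyclotomicAut_pow_val (hζ : ζ ^ p = 1) (u : (ZMod p)ˣ) (a : ZMod p) :
    cyclotomicAut L u (ζ ^ a.val) = ζ ^ ((u : ZMod p) * a).val := by
  rw [map_pow, IsCyclotomicExtension.Rat.galEquivZMod_apply_of_pow_eq p L _ hζ, cyclotomicAut,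
    MulEquiv.apply_symm_apply, pow_val_mul_of_pow_eq_one hζ]

/-- Squaring is congruent modulo `2` to the Frobenius automorphism at `2`. -/
theorem IsPrimitiveRoot.exists_sq_eq_cyclotomicAut_add (hζ : IsPrimitiveRoot ζ p) {u : (ZMod p)ˣ}
    (hu : (u : ZMod p) = 2) {x : L} (hx : IsIntegral ℤ x) :
    ∃ y, IsIntegral ℤ y ∧ x ^ 2 = cyclotomicAut L u x + 2 * y := by
  have hint : ∀ {z : L}, z ∈ Algebra.adjoin ℤ {ζ} → IsIntegral ℤ z := fun h =>
    adjoin_le_integralClosure (hζ.isIntegral (NeZero.pos p)) h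
  have h := hζ.mem_adjoin_of_isIntegral hx
  clear hx
  -- Modulo 2 both sides are ring homomorphisms in x, and they agree on the generator ζ.
  induction h using Algebra.adjoin_induction with
  | mem x hx =>
    rw [Set.mem_singleton_iff.1 hx]
    refine ⟨0, isIntegral_zero, ?_⟩
    have h1 := cyclotomicAut_pow_val hζ.pow_eq_one u ((1 : ℕ) : ZMod p)
    have h2 : (u : ZMod p) * (1 : ℕ) = (2 : ℕ) := by rw [hu]; norm_num
    rw [h2, pow_val_natCast_of_pow_eq_one hζ.pow_eq_one,
      pow_val_natCast_of_pow_eq_one hζ.pow_eq_one, pow_one] at h1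
    rw [h1]; ring
  | algebraMap r =>
    obtain ⟨k, hk⟩ : (2 : ℤ) ∣ r ^ 2 - r := by
      have := Int.even_mul_pred_self r
      rw [show r ^ 2 - r = r * (r - 1) by ring]
      exact this.two_dvd
    refine ⟨k, isIntegral_algebraMap (R := ℤ) (x := k), ?_⟩
    have : ((r : L)) ^ 2 - r = 2 * k := by exact_mod_cast congrArg (Int.cast (R := L)) hk
    simp only [eq_intCast, map_intCast]
    linear_combination this
  | add x y hx hy ihx ihy =>
    obtain ⟨a, ha, ea⟩ := ihx
    obtain ⟨b, hb, eb⟩ := ihy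
    exact ⟨a + b + x * y, (ha.add hb).add ((hint hx).mul (hint hy)), by
      rw [map_add]; linear_combination ea + eb⟩
  | mul x y hx hy ihx ihy =>
    obtain ⟨a, ha, ea⟩ := ihx
    obtain ⟨b, hb, eb⟩ := ihy
    refine ⟨x ^ 2 * b + y ^ 2 * a - (a * b + a * b), ?_, ?_⟩
    · exact ((((hint hx).pow 2).mul hb).add (((hint hy).pow 2).mul ha)).sub
        ((ha.mul hb).add (ha.mul hb))
    · rw [map_mul]; linear_combination (y ^ 2 - 2 * b) * ea + cyclotomicAut L u x * eb

end Cyclotomic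

/-! ### Gaussian periods and the cubic field. -/

section Period

theorem cubicPeriod_mem {L : Type*} [Field L] [CharZero L] {ν μ : ℕ} (ζ : L)
    (g : (ZMod ν)ˣ) (i : Fin 3) :
    cubicPeriod ν μ ζ g i ∈ cubicPeriodField ν μ ζ g :=
  IntermediateField.subset_adjoin _ _ ⟨i, rfl⟩

theorem isIntegral_cubicPeriod {L : Type*} [Field L] {ν μ : ℕ} [NeZero ν] {ζ : L}
    {g : (ZMod ν)ˣ} (hζ : IsPrimitiveRoot ζ ν) (i : Fin 3) :
    IsIntegral ℤ (cubicPeriod ν μ ζ g i) :=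
  IsIntegral.sum _ fun _ _ => (hζ.isIntegral (NeZero.pos ν)).pow _

variable {L : Type*} [Field L] [NumberField L] {ν μ : ℕ} [Fact ν.Prime]
  [IsCyclotomicExtension {ν} ℚ L] {ζ : L} {g : (ZMod ν)ˣ}

theorem orderOf_of_zpowers_eq_top (hνμ : ν = 3 * μ + 1) (hg : ∀ x, x ∈ Subgroup.zpowers g) :
    orderOf g = 3 * μ := by
  rw [orderOf_eq_card_of_forall_mem_zpowers hg, Nat.card_eq_fintype_card, ZMod.card_units, hνμ]
  simp

theorem cyclotomicAut_cubicPeriod_zero (hζ : IsPrimitiveRoot ζ ν) (g : (ZMod ν)ˣ) (r : Fin 3) :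
    cyclotomicAut L (g ^ (r : ℕ)) (cubicPeriod ν μ ζ g 0) = cubicPeriod ν μ ζ g r := by
  simp only [cubicPeriod, map_sum, cyclotomicAut_pow_val hζ.pow_eq_one, ← Units.val_mul, ← pow_add]
  exact Finset.sum_congr rfl fun j _ => by rw [Fin.val_zero, add_zero, add_comm]

theorem cyclotomicAut_cubicPeriod (hζ : IsPrimitiveRoot ζ ν) (hg : g ^ (3 * μ) = 1) (i : Fin 3) :
    cyclotomicAut L (g ^ 3) (cubicPeriod ν μ ζ g i) = cubicPeriod ν μ ζ g i := by
  simp only [cubicPeriod, map_sum, cyclotomicAut_pow_val hζ.pow_eq_one, ← Units.val_mul, ← pow_add]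
  let f : ℕ → L := fun j => ζ ^ ((g ^ (3 * j + (i : ℕ)) : (ZMod ν)ˣ) : ZMod ν).val
  have h1 := Finset.sum_range_succ f μ
  -- The automorphism shifts j to j + 1; the term j = μ wraps around to j = 0.
  rw [Finset.sum_range_succ'] at h1
  have h2 : f μ = f 0 := by simp only [f, pow_add, hg, mul_zero, pow_zero]
  rw [h2] at h1
  refine Eq.trans (Finset.sum_congr rfl fun j _ => ?_) (add_right_cancel h1)
  simp only [f]
  congr 4; ring

/-- The exponents 3j + i stay below the order of g, so only the term j = 0 can meet 1, g or g².
These three coordinates suffice to separate the periods. -/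
theorem repr_cubicPeriod (hζ : IsPrimitiveRoot ζ ν) (hνμ : ν = 3 * μ + 1)
    (hg : orderOf g = 3 * μ) (i k : Fin 3) :
    hζ.unitsPowBasis.repr (cubicPeriod ν μ ζ g i) (g ^ (k : ℕ)) = if i = k then 1 else 0 := by
  have hμ : 0 < μ := by
    have : ν.Prime := Fact.out
    rcases Nat.eq_zero_or_pos μ with h | h
    · subst h; subst hνμ; exact absurd this (by norm_num)
    · exact h
  simp only [cubicPeriod, ← hζ.unitsPowBasis_apply, map_sum, Module.Basis.repr_self,
    Finsupp.finsetSum_apply, Finsupp.single_apply]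
  have hiff : ∀ j ∈ Finset.range μ, g ^ (3 * j + (i : ℕ)) = g ^ (k : ℕ) ↔ (j = 0 ∧ i = k) := by
    intro j hj
    have hj := Finset.mem_range.1 hj
    rw [pow_inj_mod, hg, Nat.mod_eq_of_lt (by omega), Nat.mod_eq_of_lt (by omega)]
    omega
  rw [Finset.sum_congr rfl fun j hj => by rw [if_congr (hiff j hj) rfl rfl]]
  by_cases h : i = k <;> simp [h, hμ]

theorem cubicPeriodField_le_fixedField (hζ : IsPrimitiveRoot ζ ν) (hg : g ^ (3 * μ) = 1) :
    cubicPeriodField ν μ ζ g ≤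
      IntermediateField.fixedField (Subgroup.zpowers (cyclotomicAut L (g ^ 3))) := by
  rw [cubicPeriodField, IntermediateField.adjoin_le_iff]
  rintro _ ⟨i, rfl⟩
  rw [SetLike.mem_coe, IntermediateField.mem_fixedField_iff]
  intro f hf
  have h : cyclotomicAut L (g ^ 3) ∈ MulAction.stabilizer Gal(L/ℚ) (cubicPeriod ν μ ζ g i) :=
    cyclotomicAut_cubicPeriod hζ hg i
  exact Subgroup.zpowers_le.2 h hf

theorem cyclotomicAut_apply_of_mem (hζ : IsPrimitiveRoot ζ ν) (hg : g ^ (3 * μ) = 1) (q : ℕ) {x : L}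
    (hx : x ∈ cubicPeriodField ν μ ζ g) : cyclotomicAut L (g ^ (3 * q)) x = x := by
  rw [pow_mul, map_pow]
  exact (IntermediateField.mem_fixedField_iff _ _).1 (cubicPeriodField_le_fixedField hζ hg hx) _
    (Subgroup.npow_mem_zpowers _ q)

theorem linearIndependent_cubicPeriod (hζ : IsPrimitiveRoot ζ ν) (hνμ : ν = 3 * μ + 1)
    (hg : orderOf g = 3 * μ) : LinearIndependent ℚ (cubicPeriod ν μ ζ g) := by
  rw [Fintype.linearIndependent_iff]
  intro c hc k
  have h := DFunLike.congr_fun (congrArg hζ.unitsPowBasis.repr hc) (g ^ (k : ℕ))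
  simpa [map_sum, Finsupp.finsetSum_apply, repr_cubicPeriod hζ hνμ hg] using h

theorem finrank_cubicPeriodField (hζ : IsPrimitiveRoot ζ ν) (hνμ : ν = 3 * μ + 1)
    (hg : orderOf g = 3 * μ) : Module.finrank ℚ (cubicPeriodField ν μ ζ g) = 3 := by
  have hμ : 0 < μ := by
    have := orderOf_pos g
    omega
  apply le_antisymm
  -- Upper bound: K lies in a fixed field of degree 3. The lower bound comes from the independent
  -- periods.
  · set F := IntermediateField.fixedField (Subgroup.zpowers (cyclotomicAut L (g ^ 3))) with hF
    have h1 : Module.finrank F L = μ := by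
      rw [hF, IntermediateField.finrank_fixedField_eq_card, Nat.card_zpowers,
        MulEquiv.orderOf_eq,
        orderOf_pow_of_dvd (by norm_num) (by rw [hg]; exact dvd_mul_right _ _), hg]
      omega
    have h2 : Module.finrank ℚ L = 3 * μ := by
      rw [Module.finrank_eq_card_basis hζ.unitsPowBasis, ZMod.card_units, hνμ]
      rfl
    have h3 := Module.finrank_mul_finrank ℚ F L
    rw [h1, h2] at h3
    rw [← Nat.eq_of_mul_eq_mul_right hμ h3]
    exact IntermediateField.finrank_le_of_le_right
      (cubicPeriodField_le_fixedField hζ (hg ▸ pow_orderOf_eq_one g))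
  · let v : Fin 3 → cubicPeriodField ν μ ζ g := fun i => ⟨_, cubicPeriod_mem ζ g i⟩
    have hv : LinearIndependent ℚ v := LinearIndependent.of_comp
      (cubicPeriodField ν μ ζ g).val.toLinearMap (linearIndependent_cubicPeriod hζ hνμ hg)
    simpa using hv.fintype_card_le_finrank

end Period

/-! ### Index divisibility by 2 and cubes modulo ν. -/

section Period

variable {L : Type*} [Field L] [NumberField L] {ν μ : ℕ} [Fact ν.Prime]
  [IsCyclotomicExtension {ν} ℚ L] {ζ : L} {g : (ZMod ν)ˣ}

/-- The prime `2` is a common index divisor of the cubic period field if and only if `2` is a cube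
modulo `ν`. -/
theorem isCommonInessentialDiscriminantDivisor_two_iff (hζ : IsPrimitiveRoot ζ ν)
    (hνμ : ν = 3 * μ + 1) (hg : orderOf g = 3 * μ) {m : ℕ} (hm : ((g ^ m : (ZMod ν)ˣ) : ZMod ν) = 2) :
    IsCommonInessentialDiscriminantDivisor (cubicPeriodField ν μ ζ g) 2 ↔ 3 ∣ m := by
  have hrank : Module.finrank ℤ (𝓞 (cubicPeriodField ν μ ζ g)) = 3 := by
    rw [NumberField.RingOfIntegers.rank, finrank_cubicPeriodField hζ hνμ hg]
  have hg1 : g ^ (3 * μ) = 1 := hg ▸ pow_orderOf_eq_one g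
  -- φ identifies 𝓞 K with the integers of L lying in K, so that all computations take place in L.
  obtain ⟨φ, hφ, hmem, hint, hlift⟩ : ∃ φ : 𝓞 (cubicPeriodField ν μ ζ g) →+* L,
      Function.Injective φ ∧ (∀ θ, φ θ ∈ cubicPeriodField ν μ ζ g) ∧ (∀ θ, IsIntegral ℤ (φ θ)) ∧
      ∀ x ∈ cubicPeriodField ν μ ζ g, IsIntegral ℤ x → ∃ η, φ η = x := by
    refine ⟨(cubicPeriodField ν μ ζ g).val.toRingHom.comp (algebraMap _ _), ?_, fun θ => ?_,
      fun θ => ?_, fun x hx hxi => ?_⟩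
    · exact Subtype.val_injective.comp NumberField.RingOfIntegers.coe_injective
    · exact Subtype.mem _
    · exact (NumberField.RingOfIntegers.isIntegral_coe θ).map (cubicPeriodField ν μ ζ g).val
    · exact ⟨⟨⟨x, hx⟩, (isIntegral_algHom_iff ((cubicPeriodField ν μ ζ g).val.restrictScalars ℤ)
        Subtype.val_injective).1 hxi⟩, rfl⟩
  constructor
  · intro h
    obtain ⟨θ, hθ⟩ := hlift _ (cubicPeriod_mem ζ g 0) (isIntegral_cubicPeriod hζ 0)
    obtain ⟨a, ⟨k, hk, hak⟩, η, e⟩ := (dvd_inessentialPart_iff _ Nat.prime_two θ).1 (h θ)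
    rw [hrank] at hk e
    obtain ⟨y, hy, hsq⟩ := hζ.exists_sq_eq_cyclotomicAut_add hm
      (isIntegral_cubicPeriod (μ := μ) (g := g) hζ 0)
    obtain ⟨r, hr⟩ : ∃ r : Fin 3, (r : ℕ) = m % 3 := ⟨⟨m % 3, Nat.mod_lt _ (by norm_num)⟩, rfl⟩
    have hS : cyclotomicAut L (g ^ m) (cubicPeriod ν μ ζ g 0) = cubicPeriod ν μ ζ g r := by
      conv_lhs => rw [← Nat.mod_add_div m 3, pow_add, map_mul, AlgEquiv.mul_apply,
        cyclotomicAut_apply_of_mem hζ hg1 _ (cubicPeriod_mem ζ g 0), ← hr,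
        cyclotomicAut_cubicPeriod_zero hζ]
    rw [hS] at hsq
    have e1 := congrArg φ e
    simp only [Finset.sum_range_succ, Finset.sum_range_zero, map_add, map_mul, map_pow, map_intCast,
      zero_add, pow_zero, pow_one, mul_one, Nat.cast_ofNat, map_ofNat, hθ] at e1
    by_contra h3
    have hr0 : r ≠ 0 := by
      intro h0; rw [h0] at hr; simp at hr; omega
    -- Coordinates at 1, g, g² of a₀ + a₁ε₀ + a₂ε_r ≡ 0, where 1 has all coordinates -1. The index
    -- other than 0 and r forces a₀ even, then a₁ and a₂ are even too.
    have hcoord : ∀ i : Fin 3, (2 : ℤ) ∣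
        -a 0 + a 1 * (if 0 = i then 1 else 0) + a 2 * (if r = i then 1 else 0) := by
      intro i
      obtain ⟨n, hn⟩ := hζ.exists_unitsPowBasis_repr_eq_intCast (hint η) (g ^ (i : ℕ))
      obtain ⟨n', hn'⟩ := hζ.exists_unitsPowBasis_repr_eq_intCast hy (g ^ (i : ℕ))
      have e2 : (a 0 : ℚ) • (1 : L) + (a 1 : ℚ) • cubicPeriod ν μ ζ g 0 +
          (a 2 : ℚ) • (cubicPeriod ν μ ζ g r + (2 : ℚ) • y) =
          (2 : ℚ) • φ η := by
        simp only [Algebra.smul_def, map_intCast, map_ofNat]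
        rw [← hsq, mul_one, e1]
      have e3 := DFunLike.congr_fun (congrArg hζ.unitsPowBasis.repr e2) (g ^ (i : ℕ))
      simp only [map_add, map_smul, Finsupp.add_apply, Finsupp.smul_apply, smul_eq_mul, hn, hn',
        hζ.unitsPowBasis_repr_one, repr_cubicPeriod hζ hνμ hg] at e3
      refine ⟨n - a 2 * n', ?_⟩
      have : ((-a 0 + a 1 * (if 0 = i then 1 else 0) + a 2 * (if r = i then 1 else 0) : ℤ) : ℚ) =
          ((2 * (n - a 2 * n') : ℤ) : ℚ) := by
        push_cast; linear_combination e3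
      exact_mod_cast this
    have h0 := hcoord 0
    have h1 := hcoord 1
    have h2 := hcoord 2
    rw [Nat.cast_ofNat] at hak
    fin_cases r <;> interval_cases k <;> simp at h0 h1 h2 hr0 <;> omega
  · intro h3 θ
    obtain ⟨q, rfl⟩ := h3
    rw [dvd_inessentialPart_iff _ Nat.prime_two, hrank]
    obtain ⟨y, hy, hsq⟩ := hζ.exists_sq_eq_cyclotomicAut_add hm (hint θ)
    rw [cyclotomicAut_apply_of_mem hζ hg1 _ (hmem θ)] at hsq
    have hyK : y ∈ cubicPeriodField ν μ ζ g := by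
      have : y = (φ θ ^ 2 - φ θ) / ((2 : ℕ) : L) := by
        rw [hsq, Nat.cast_ofNat]; field_simp; ring
      rw [this]
      exact div_mem (sub_mem (pow_mem (hmem θ) 2) (hmem θ)) (natCast_mem _ 2)
    obtain ⟨η, hη⟩ := hlift y hyK hy
    -- The dependence relation is θ² - θ ≡ 0 modulo 2.
    refine ⟨fun k => if k = 0 then 0 else if k = 1 then -1 else 1, ⟨2, by norm_num, by norm_num⟩,
      η, hφ ?_⟩
    have hsum : -φ θ + φ θ ^ 2 = 2 * φ η := by rw [hsq, hη]; ring
    rw [map_mul, map_natCast, Nat.cast_ofNat, ← hsum]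
    simp [Finset.sum_range_succ]

end Period

/-- A character of order `3` takes the value `1` exactly at the cubes. -/
theorem MulChar.apply_pow_eq_one_iff_three_dvd {F R : Type*} [CommMonoid F] [CommRing R]
    {χ : MulChar F R}
    (hχ : orderOf χ = 3) {g : Fˣ} (hg : ∀ x, x ∈ Subgroup.zpowers g) (m : ℕ) :
    χ ((g ^ m : Fˣ) : F) = 1 ↔ 3 ∣ m := by
  have h3 : χ g ^ 3 = 1 := by
    rw [← MulChar.pow_apply' χ (by norm_num), ← hχ, pow_orderOf_eq_one,
      MulChar.one_apply g.isUnit]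
  have h1 : χ g ≠ 1 := by
    intro h
    have : χ = 1 := by
      ext x
      obtain ⟨n, rfl⟩ := hg x
      have h' : MulChar.equivToUnitHom χ g = 1 := Units.ext (by simpa using h)
      have : MulChar.equivToUnitHom χ (g ^ n) = 1 := by rw [map_zpow, h', one_zpow]
      rw [MulChar.one_apply_coe, ← MulChar.coe_equivToUnitHom, this, Units.val_one]
    rw [this, orderOf_one] at hχ
    omega
  rw [Units.val_pow_eq_pow_val, map_pow, ← orderOf_dvd_iff_pow_eq_one,
    orderOf_eq_prime h3 h1]

/-- Let `ν = 3 μ + 1` be a prime and let `K` be the field generated by the three `μ`-fold periods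
of the `ν`-th roots of unity. Then `K` is a cyclic cubic field, and `2` is a common inessential
discriminant divisor of `K` if and only if `ν = A ^ 2 + 27 * B ^ 2` for some integers `A`, `B`. -/
theorem mainTheorem5 (ν μ : ℕ) (hν : ν.Prime) (hνμ : ν = 3 * μ + 1)
    (L : Type*) [Field L] [NumberField L] [IsCyclotomicExtension {ν} ℚ L]
    (ζ : L) (hζ : IsPrimitiveRoot ζ ν)
    (g : (ZMod ν)ˣ) (hg : ∀ x : (ZMod ν)ˣ, x ∈ Subgroup.zpowers g) :
    (Module.finrank ℚ (cubicPeriodField ν μ ζ g) = 3 ∧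
      IsGalois ℚ (cubicPeriodField ν μ ζ g) ∧
      IsCyclic (cubicPeriodField ν μ ζ g ≃ₐ[ℚ] cubicPeriodField ν μ ζ g)) ∧
    (IsCommonInessentialDiscriminantDivisor (cubicPeriodField ν μ ζ g) 2 ↔
      ∃ A B : ℤ, (ν : ℤ) = A ^ 2 + 27 * B ^ 2) := by
  have : Fact ν.Prime := ⟨hν⟩
  have hord := orderOf_of_zpowers_eq_top hνμ hg
  have hfin := finrank_cubicPeriodField hζ hνμ hord
  have := IsCyclotomicExtension.isAbelianGalois {ν} ℚ L
  have hgal : IsGalois ℚ (cubicPeriodField ν μ ζ g) := (IsAbelianGalois.tower_bot ℚ _ L).toIsGalois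
  refine ⟨⟨hfin, hgal, ?_⟩, ?_⟩
  · have : Fact (Nat.Prime 3) := ⟨Nat.prime_three⟩
    exact isCyclic_of_prime_card (p := 3) (by rw [IsGalois.card_aut_eq_finrank, hfin])
  · have hdvd : 3 ∣ ν - 1 := ⟨μ, by omega⟩
    have hν2 : ν ≠ 2 := by omega
    have h2 : (2 : ZMod ν) ≠ 0 := Ring.two_ne_zero (by rwa [ZMod.ringChar_zmod_n])
    obtain ⟨m, hm⟩ : ∃ m : ℕ, g ^ m = Units.mk0 2 h2 :=
      (mem_powers_iff_mem_zpowers.2 (hg (Units.mk0 2 h2)))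
    have hm' : ((g ^ m : (ZMod ν)ˣ) : ZMod ν) = 2 := by rw [hm, Units.val_mk0]
    obtain ⟨χ, hχ⟩ := MulChar.exists_mulChar_orderOf (ZMod ν) (R := ℂ) (n := 3)
      (by rwa [ZMod.card]) (Complex.isPrimitiveRoot_exp 3 (by norm_num))
    rw [isCommonInessentialDiscriminantDivisor_two_iff hζ hνμ hord hm',
      ← MulChar.apply_pow_eq_one_iff_three_dvd hχ hg m, hm',
      MulChar.apply_two_eq_one_iff_exists_sq_add_mul_sq hχ hdvd]
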